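/- All 2-complexes are combinatorial: a 2-complex is a graph (loops and multiple edges allowed) with 2-cells attached along closed edge paths of length at least one. Let $L$ be a 2-complex and $K\subseteq L$ a subcomplex. The link $lk(v,L)$ of a vertex $v$ is the graph whose vertices are the ends of edges at $v$ and whose edges are the corners at $v$ of the 2-cells of $L$; $lk(v,K)$ is its subgraph coming from $K$. A cycle (closed edge path) $e_1\cdots e_n$ in a graph is *homology reduced* if there is no pair $e_i,e_j$ with $e_j=\bar e_i$, where $\bar e_i$ is $e_i$ with reversed orientation. A *zero/one angle structure* on $L$ assigns to every corner $c$ of a 2-cell of $L$ a number $\omega(c)\in\{0,1\}$. The *curvature* of a 2-cell $d$ is $\kappa(d)=\sum\omega(c_j)-(|\partial d|-2)$, where the sum is over all corners $c_j$ of $d$ and $|\partial d|$ is the length of its boundary. The pair $(L,K)$ satisfies the *relative coloring test* if (1) $\kappa(d)\le 0$ for every 2-cell $d$ of $L-K$, and (2) for every vertex $v$ of $L$ and every homology reduced cycle $c_1\cdots c_n$ in $lk(v,L)$ that is not entirely contained in $lk(v,K)$, $2-\sum_{i=1}^n\omega(c_i)\le 0$. A *combinatorial map* maps open cells homeomorphically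 onto open cells. A *spherical diagram* over $L$ is a combinatorial map $f\colon S\to L$, where $S$ is a cell decomposition of the 2-sphere, that is, a finite, connected and simply connected 2-complex that is a closed surface (the link of every vertex is a circle). It is *vertex reduced* if, for every vertex $v$ of $S$, $f$ maps $lk(v)$ to a homology reduced cycle in $lk(f(v),L)$. It is *thin relative to $K$* if every vertex $v$ of $S$ lies in the boundary of a 2-cell $d$ of $S$ with $f(d)$ in $L-K$. **Theorem.** Let $(L,K)$ be a 2-complex pair with a zero/one angle structure that satisfies the relative coloring test, and suppose that $\kappa(d)\le 0$ for all 2-cells $d$ of $L$. If $f\colon S\to L$ is a spherical diagram that is thin relative to $K$, then $f$ is not vertex reduced. -/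

import Mathlib

universe u v

/-- A graph (loops and multiple edges allowed) in the sense of Serre: `E` is the type of
oriented edges, `inv` reverses the orientation, so a geometric edge is a pair `{e, inv e}`. -/
structure SerreGraph where
  V : Type u
  E : Type u
  src : E → V
  inv : E → E
  inv_inv : ∀ e, inv (inv e) = e
  inv_ne : ∀ e, inv e ≠ e

namespace SerreGraph

/-- The terminal vertex of an oriented edge. -/
def tgt (G : SerreGraph.{u}) (e : G.E) : G.V := G.src (G.inv e)

/-- `G.IsWalk x l y`: the list `l` of oriented edges is an edge path from `x` to `y`. -/
def IsWalk (G : SerreGraph.{u}) : G.V → List G.E → G.V → Prop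
  | x, [], y => x = y
  | x, e :: l, y => G.src e = x ∧ G.IsWalk (G.tgt e) l y

/-- A cycle of edges `e₁ ⋯ eₙ` (a closed edge path), cyclically indexed by `ZMod n`. -/
def IsCycle (G : SerreGraph.{u}) {n : ℕ} (c : ZMod n → G.E) : Prop :=
  ∀ i, G.tgt (c i) = G.src (c (i + 1))

/-- A cycle `e₁ ⋯ eₙ` is homology reduced if there is no pair `eᵢ, eⱼ` with `eⱼ = ēᵢ`. -/
def IsHomologyReduced (G : SerreGraph.{u}) {n : ℕ} (c : ZMod n → G.E) : Prop :=
  G.IsCycle c ∧ ∀ i j, c j ≠ G.inv (c i)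

/-- `c` runs once around the graph `G`, and `G` is a circle: every vertex is the initial vertex
of exactly one `c i`, and every geometric edge is traversed exactly once. -/
structure IsCircuit (G : SerreGraph.{u}) {n : ℕ} (c : ZMod n → G.E) : Prop where
  isCycle : G.IsCycle c
  vertex : ∀ x : G.V, ∃! i, G.src (c i) = x
  edge : ∀ e : G.E, ∃! i, c i = e ∨ c i = G.inv e

/-- `G` is a circle, subdivided into `n ≥ 1` edges. -/
def IsCircle (G : SerreGraph.{u}) : Prop :=
  ∃ n : ℕ, 0 < n ∧ ∃ c : ZMod n → G.E, G.IsCircuit c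

/-- Maps of graphs, sending vertices to vertices and edges to edges. -/
structure Hom (G : SerreGraph.{u}) (H : SerreGraph.{v}) where
  onV : G.V → H.V
  onE : G.E → H.E
  src : ∀ e, H.src (onE e) = onV (G.src e)
  inv : ∀ e, H.inv (onE e) = onE (G.inv e)

end SerreGraph

/-- A 2-complex: a graph (the 1-skeleton) together with 2-cells, each 2-cell `d` being attached
along a closed edge path `bd d` of length `len d ≥ 1`, cyclically indexed by `ZMod (len d)`. -/
structure TwoComplex extends SerreGraph.{u} where
  F : Type u
  len : F → ℕ
  len_ne : ∀ d, NeZero (len d)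
  bd : (d : F) → ZMod (len d) → E
  bd_cycle : ∀ d, toSerreGraph.IsCycle (bd d)

attribute [instance] TwoComplex.len_ne

namespace TwoComplex

/-- The corners of the 2-cells. The corner `⟨d, i⟩` of `d` lies between the consecutive
boundary edges `bd d i` and `bd d (i + 1)`. -/
structure Corner (X : TwoComplex.{u}) where
  cell : X.F
  idx : ZMod (X.len cell)

/-- The vertex at which a corner is located. -/
def Corner.vertex {X : TwoComplex.{u}} (c : X.Corner) : X.V := X.src (X.bd c.cell (c.idx + 1))

/-- The link of the vertex `x`. Its vertices are the ends of edges at `x`, that is, the oriented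
edges starting at `x`. Its oriented edges are the oriented corners `(c, o)` at `x`: the corner
`c = ⟨d, i⟩` joins the end of `bd d i` (the start of its inverse) to the start of
`bd d (i + 1)`, in this direction if `o = true` and in the opposite one if `o = false`. -/
def lk (X : TwoComplex.{u}) (x : X.V) : SerreGraph.{u} where
  V := {e : X.E // X.src e = x}
  E := {c : X.Corner × Bool // c.1.vertex = x}
  src := fun
    | ⟨(c, true), h⟩ => ⟨X.inv (X.bd c.cell c.idx), (X.bd_cycle c.cell c.idx).trans h⟩
    | ⟨(c, false), h⟩ => ⟨X.bd c.cell (c.idx + 1), h⟩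
  inv := fun c => ⟨(c.1.1, !c.1.2), c.2⟩
  inv_inv := by rintro ⟨⟨c, o⟩, h⟩; simp
  inv_ne := by rintro ⟨⟨c, o⟩, h⟩; simp

/-- The curvature of a 2-cell `d` of a 2-complex with angles `ω`:
`κ(d) = ∑ ω(c) - (|∂d| - 2)`, the sum being over the corners of `d`. -/
noncomputable def curvature (X : TwoComplex.{u}) (ω : X.Corner → ℝ) (d : X.F) : ℝ :=
  ∑ i : ZMod (X.len d), ω ⟨d, i⟩ - ((X.len d : ℝ) - 2)

/-- A zero/one angle structure. -/
def IsZeroOneAngle (X : TwoComplex.{u}) (ω : X.Corner → ℝ) : Prop :=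
  ∀ c, ω c = 0 ∨ ω c = 1

/-- Subcomplexes: sets of vertices, edges and 2-cells, closed under passing to the boundary. -/
structure Subcomplex (L : TwoComplex.{u}) where
  V : Set L.V
  E : Set L.E
  F : Set L.F
  src_mem : ∀ e ∈ E, L.src e ∈ V
  inv_mem : ∀ e ∈ E, L.inv e ∈ E
  bd_mem : ∀ d ∈ F, ∀ i, L.bd d i ∈ E

/-- The edges of the subgraph `lk(x, K)` of `lk(x, L)`: the corners of 2-cells of `K`. -/
def Subcomplex.lkEdges {L : TwoComplex.{u}} (K : L.Subcomplex) (x : L.V) : Set (L.lk x).E :=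
  {c | c.1.1.cell ∈ K.F}

/-- The relative coloring test for the pair `(L, K)`, where `L` carries the angles `ω`. -/
structure RelativeColoringTest (L : TwoComplex.{u}) (K : L.Subcomplex) (ω : L.Corner → ℝ) :
    Prop where
  curvature_nonpos : ∀ d, d ∉ K.F → L.curvature ω d ≤ 0
  cycle : ∀ (x : L.V) (n : ℕ) [NeZero n] (c : ZMod n → (L.lk x).E),
    (L.lk x).IsHomologyReduced c → ¬ (∀ i, c i ∈ K.lkEdges x) →
    2 - ∑ i, ω (c i).1.1 ≤ 0

/-- The attaching path of `d`, as a list of oriented edges. -/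
def bdList (X : TwoComplex.{u}) (d : X.F) : List X.E :=
  (List.range (X.len d)).map fun i => X.bd d (i : ZMod (X.len d))

/-- Elementary reductions of edge paths: deleting a backtrack `e ē`, or the boundary path of
a 2-cell. -/
inductive ElementaryReduction (X : TwoComplex.{u}) : List X.E → List X.E → Prop
  | backtrack (l₁ l₂ : List X.E) (e : X.E) :
      ElementaryReduction X (l₁ ++ [e, X.inv e] ++ l₂) (l₁ ++ l₂)
  | cell (l₁ l₂ : List X.E) (d : X.F) :
      ElementaryReduction X (l₁ ++ X.bdList d ++ l₂) (l₁ ++ l₂)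

/-- Homotopy of closed edge paths based at `x`: the equivalence relation generated by
elementary reductions between closed edge paths at `x`. -/
def Homotopic (X : TwoComplex.{u}) (x : X.V) : List X.E → List X.E → Prop :=
  Relation.EqvGen fun l l' => X.IsWalk x l x ∧ X.IsWalk x l' x ∧ X.ElementaryReduction l l'

/-- `X` is a cell decomposition of the 2-sphere: a finite 2-complex that is a closed surface
(all links of vertices are circles), nonempty, connected and simply connected. -/
structure IsSphere (X : TwoComplex.{u}) : Prop where
  finite_V : Finite X.V
  finite_E : Finite X.E
  finite_F : Finite X.F
  nonempty : Nonempty X.V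
  surface : ∀ x, (X.lk x).IsCircle
  connected : ∀ x y, ∃ l, X.IsWalk x l y
  simplyConnected : ∀ x l, X.IsWalk x l x → X.Homotopic x l []

/-- Combinatorial maps: open cells are mapped homeomorphically to open cells. A 2-cell `d` is
mapped to the 2-cell `onF d`; this identifies the boundary cycle of `d` with the one of `onF d`
by a bijection `side d` of the boundary edges, which preserves the direction of the boundary if
`flip d = false` and reverses it if `flip d = true`. -/
structure CombMap (X : TwoComplex.{u}) (Y : TwoComplex.{v}) extends
    SerreGraph.Hom X.toSerreGraph Y.toSerreGraph where
  onF : X.F → Y.F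
  flip : X.F → Bool
  side : (d : X.F) → ZMod (X.len d) ≃ ZMod (Y.len (onF d))
  side_add : ∀ d, flip d = false → ∀ i, side d (i + 1) = side d i + 1
  bd_side : ∀ d, flip d = false → ∀ i, Y.bd (onF d) (side d i) = onE (X.bd d i)
  side_flip : ∀ d, flip d = true → ∀ i, side d (i + 1) + 1 = side d i
  bd_flip : ∀ d, flip d = true → ∀ i, Y.bd (onF d) (side d i) = Y.inv (onE (X.bd d i))

namespace CombMap

variable {X : TwoComplex.{u}} {Y : TwoComplex.{v}}

/-- The map on corners: the corner of `d` between the `i`-th and the `(i+1)`-st boundary edge goes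
to the corner of `onF d` between the images of these two edges. -/
def onCorner (f : CombMap X Y) (c : X.Corner) : Y.Corner :=
  ⟨f.onF c.cell,
    if f.flip c.cell then f.side c.cell (c.idx + 1) else f.side c.cell c.idx⟩

theorem onCorner_of_not_flip (f : CombMap X Y) {d : X.F} (h : f.flip d = false)
    (i : ZMod (X.len d)) : f.onCorner ⟨d, i⟩ = ⟨f.onF d, f.side d i⟩ := by
  simp [onCorner, h]

theorem onCorner_of_flip (f : CombMap X Y) {d : X.F} (h : f.flip d = true)
    (i : ZMod (X.len d)) : f.onCorner ⟨d, i⟩ = ⟨f.onF d, f.side d (i + 1)⟩ := by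
  simp [onCorner, h]

theorem onCorner_vertex (f : CombMap X Y) (c : X.Corner) :
    (f.onCorner c).vertex = f.onV c.vertex := by
  obtain ⟨d, i⟩ := c
  cases h : f.flip d
  · rw [f.onCorner_of_not_flip h]
    change Y.src (Y.bd (f.onF d) (f.side d i + 1)) = f.onV (X.src (X.bd d (i + 1)))
    rw [← f.side_add d h, f.bd_side d h, f.src]
  · rw [f.onCorner_of_flip h]
    change Y.src (Y.bd (f.onF d) (f.side d (i + 1) + 1)) = f.onV (X.src (X.bd d (i + 1)))
    rw [f.side_flip d h, f.bd_flip d h, f.inv, f.src]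
    exact congrArg f.onV (X.bd_cycle d i)

/-- The map `lk(x) → lk(f(x))` induced by a combinatorial map. An oriented corner keeps its
orientation relative to the boundary of the 2-cell unless the 2-cell is flipped. -/
def onLk (f : CombMap X Y) (x : X.V) : (X.lk x).Hom (Y.lk (f.onV x)) where
  onV := fun e => ⟨f.onE e.1, (f.src e.1).trans (congrArg f.onV e.2)⟩
  onE := fun c => ⟨(f.onCorner c.1.1, xor (f.flip c.1.1.cell) c.1.2),
    (f.onCorner_vertex c.1.1).trans (congrArg f.onV c.2)⟩
  src := by
    rintro ⟨⟨⟨d, i⟩, o⟩, hx⟩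
    apply Subtype.ext
    cases h : f.flip d <;> cases o <;>
      simp only [onCorner, lk, h, if_true, if_false, Bool.false_eq_true, Bool.xor_false,
        Bool.xor_true, Bool.not_true, Bool.not_false]
    · rw [← f.side_add d h, f.bd_side d h]
    · rw [f.bd_side d h, f.inv]
    · rw [f.bd_flip d h, Y.inv_inv]
    · rw [f.side_flip d h, f.bd_flip d h, f.inv]
  inv := by
    rintro ⟨⟨⟨d, i⟩, o⟩, hx⟩
    cases h : f.flip d <;> cases o <;> simp [lk, h]

/-- `f : X → Y` is vertex reduced: for every vertex `x` of `X` it maps `lk(x)`, a circle, to a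
homology reduced cycle. -/
def IsVertexReduced (f : CombMap X Y) : Prop :=
  ∀ (x : X.V) (n : ℕ) [NeZero n] (c : ZMod n → (X.lk x).E), (X.lk x).IsCircuit c →
    (Y.lk (f.onV x)).IsHomologyReduced fun i => (f.onLk x).onE (c i)

/-- `f : X → Y` is thin relative to `K`: every vertex of `X` lies in the boundary of a 2-cell
that `f` does not map to a 2-cell of `K`. -/
def IsThin (f : CombMap X Y) (K : Y.Subcomplex) : Prop :=
  ∀ x : X.V, ∃ d : X.F, (∃ i, X.src (X.bd d i) = x) ∧ f.onF d ∉ K.F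

end CombMap

end TwoComplex

/-! A combinatorial Gauss–Bonnet argument. Pull the angles back to S and suppose f is vertex
reduced. Each vertex link is a circle mapped to a homology reduced cycle, which by thinness leaves
lk(K), so the angles at each vertex sum to at least 2 (`two_le_sum_angle`). Curvature is preserved
by f, so the angles in a cell d sum to at most |∂d| - 2. In a closed surface the lengths |∂d| add up
to twice the number of edges (`card_corner_eq`, `card_edge_eq`). Counting all angles both ways gives
2V ≤ 2E - 2F, against V - E + F > 0.

Positivity of the Euler characteristic (`card_geomEdge_lt`) is linear algebra over ℤ/2, where no
orientations are needed: simple connectivity makes every 1-cocycle a coboundary, so E ≤ rank δ⁰ +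
rank δ¹ ≤ (V - 1) + F. -/

namespace SerreGraph

/-- The geometric edges of a graph: pairs of mutually inverse oriented edges. -/
def edgeSetoid (G : SerreGraph.{u}) : Setoid G.E where
  r a b := a = b ∨ a = G.inv b
  iseqv := by
    refine ⟨fun _ => Or.inl rfl, ?_, ?_⟩
    · rintro a b (rfl | rfl)
      · exact Or.inl rfl
      · exact Or.inr (G.inv_inv _).symm
    · rintro a b c (rfl | rfl) (rfl | rfl)
      · exact Or.inl rfl
      · exact Or.inr rfl
      · exact Or.inr rfl
      · exact Or.inl (G.inv_inv _)

/-- The type of geometric edges. -/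
abbrev GeomEdge (G : SerreGraph.{u}) : Type u := Quotient G.edgeSetoid

/-- Since `inv` has no fixed points, each class consists of exactly two oriented edges. -/
theorem card_edge_eq (G : SerreGraph.{u}) [Fintype G.E] [Fintype G.GeomEdge] :
    Fintype.card G.E = 2 * Fintype.card G.GeomEdge := by
  classical
  have h : ∀ q ∈ (Finset.univ : Finset G.GeomEdge),
      (Finset.univ.filter fun e : G.E => (Quotient.mk _ e : G.GeomEdge) = q).card = 2 := by
    intro q _
    induction q using Quotient.inductionOn with
    | _ a =>
      have : (Finset.univ.filter fun e : G.E =>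
          (Quotient.mk _ e : G.GeomEdge) = Quotient.mk _ a) = {a, G.inv a} := by
        ext e
        simp only [Finset.mem_filter, Finset.mem_univ, true_and, Finset.mem_insert,
          Finset.mem_singleton]
        exact Quotient.eq
      rw [this, Finset.card_pair (G.inv_ne a).symm]
  rw [← Finset.card_univ, Finset.card_eq_sum_card_fiberwise
    (f := fun e : G.E => (Quotient.mk _ e : G.GeomEdge)) (t := Finset.univ) (by simp),
    Finset.sum_congr rfl h]
  simp [mul_comm]

theorem IsWalk.append {G : SerreGraph.{u}} {x y z : G.V} {l l' : List G.E}
    (h : G.IsWalk x l y) (h' : G.IsWalk y l' z) : G.IsWalk x (l ++ l') z := by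
  induction l generalizing x with
  | nil => cases h; exact h'
  | cons e l ih => exact ⟨h.1, ih h.2⟩

theorem isWalk_singleton (G : SerreGraph.{u}) (e : G.E) : G.IsWalk (G.src e) [e] (G.tgt e) :=
  ⟨rfl, rfl⟩

theorem IsWalk.reverse {G : SerreGraph.{u}} {x y : G.V} {l : List G.E} (h : G.IsWalk x l y) :
    G.IsWalk y (l.map G.inv).reverse x := by
  induction l generalizing x with
  | nil => exact Eq.symm h
  | cons e l ih =>
    rw [List.map_cons, List.reverse_cons]
    refine (ih h.2).append ⟨rfl, ?_⟩
    change G.src (G.inv (G.inv e)) = x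
    rw [G.inv_inv]
    exact h.1

end SerreGraph

namespace TwoComplex

/-! ### Cohomology with ℤ/2 coefficients and the Euler characteristic. -/

section Cohomology

variable (X : TwoComplex.{u})

/-- The coboundary of a `0`-cochain with coefficients in `ℤ/2`. -/
def coboundaryZero : (X.V → ZMod 2) →ₗ[ZMod 2] (X.GeomEdge → ZMod 2) where
  toFun g := Quotient.lift (fun e => g (X.src e) + g (X.tgt e)) (by
    rintro a b (rfl | rfl)
    · rfl
    · simp only [SerreGraph.tgt, X.inv_inv]
      exact add_comm _ _)
  map_add' g h := by
    funext q
    induction q using Quotient.inductionOn with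
    | _ e => exact add_add_add_comm _ _ _ _
  map_smul' a g := by
    funext q
    induction q using Quotient.inductionOn with
    | _ e => exact (mul_add a _ _).symm

/-- The coboundary of a `1`-cochain with coefficients in `ℤ/2`. -/
def coboundaryOne : (X.GeomEdge → ZMod 2) →ₗ[ZMod 2] (X.F → ZMod 2) where
  toFun φ d := ∑ i : ZMod (X.len d), φ (Quotient.mk _ (X.bd d i))
  map_add' φ ψ := by
    funext d
    exact Finset.sum_add_distrib
  map_smul' a φ := by
    funext d
    exact (Finset.mul_sum _ _ _).symm

variable {X}

/-- The value of a `1`-cochain on an edge path. -/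
def pathSum (φ : X.GeomEdge → ZMod 2) (l : List X.E) : ZMod 2 :=
  (l.map fun e => φ (Quotient.mk _ e)).sum

theorem pathSum_append (φ : X.GeomEdge → ZMod 2) (l l' : List X.E) :
    pathSum φ (l ++ l') = pathSum φ l + pathSum φ l' := by
  simp [pathSum]

theorem mk_inv (e : X.E) :
    (Quotient.mk _ (X.inv e) : X.GeomEdge) = Quotient.mk _ e :=
  Quotient.sound (Or.inr rfl)

theorem pathSum_reverse (φ : X.GeomEdge → ZMod 2) (l : List X.E) :
    pathSum φ (l.map X.inv).reverse = pathSum φ l := by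
  simp [pathSum, List.sum_reverse, Function.comp_def, mk_inv]

theorem pathSum_bdList (φ : X.GeomEdge → ZMod 2) (d : X.F) :
    pathSum φ (X.bdList d) = X.coboundaryOne φ d := by
  have key : ∀ (n : ℕ) [NeZero n] (g : ZMod n → ZMod 2),
      ((List.range n).map fun i : ℕ => g (i : ZMod n)).sum = ∑ i, g i := by
    intro n _ g
    rw [← List.sum_toFinset _ List.nodup_range, List.toFinset_range]
    refine Finset.sum_bij' (fun i _ => (i : ZMod n)) (fun j _ => j.val) (by simp)
      (fun j _ => Finset.mem_range.2 (ZMod.val_lt j))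
      (fun i hi => ZMod.val_cast_of_lt (Finset.mem_range.1 hi)) (by simp) (by simp)
  -- In `bdList` the list of naturals is coerced as a whole to `ZMod`, which unfolds to a monadic
  -- bind.
  have hbind : (do let a ← List.range (X.len d); pure (a : ZMod (X.len d))) =
      (List.range (X.len d)).map fun i : ℕ => (i : ZMod (X.len d)) :=
    List.flatMap_pure_eq_map _ _
  rw [pathSum, bdList, hbind, List.map_map, List.map_map]
  exact key (X.len d) fun i => φ (Quotient.mk _ (X.bd d i))

/-- A backtrack counts one value twice, which is zero mod 2; the boundary path of d contributes the
coboundary at d. Hence cocycles are homotopy invariant on closed paths. -/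
theorem ElementaryReduction.pathSum_eq {φ : X.GeomEdge → ZMod 2} (hφ : X.coboundaryOne φ = 0)
    {l l' : List X.E} (h : X.ElementaryReduction l l') : pathSum φ l = pathSum φ l' := by
  cases h with
  | backtrack l₁ l₂ e =>
    have : pathSum φ [e, X.inv e] = 0 := by
      simp [pathSum, mk_inv, CharTwo.add_self_eq_zero]
    rw [pathSum_append, pathSum_append, pathSum_append, this, add_zero]
  | cell l₁ l₂ d =>
    rw [pathSum_append, pathSum_append, pathSum_append, pathSum_bdList, hφ, Pi.zero_apply,
      add_zero]

theorem Homotopic.pathSum_eq {φ : X.GeomEdge → ZMod 2} (hφ : X.coboundaryOne φ = 0) {x : X.V}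
    {l l' : List X.E} (h : X.Homotopic x l l') : pathSum φ l = pathSum φ l' := by
  induction h with
  | rel _ _ h => exact h.2.2.pathSum_eq hφ
  | refl _ => rfl
  | symm _ _ _ ih => exact ih.symm
  | trans _ _ _ _ _ ih₁ ih₂ => exact ih₁.trans ih₂

/-- The first cohomology of a connected and simply connected complex vanishes. -/
theorem ker_coboundaryOne_le (x₀ : X.V) (hconn : ∀ x y, ∃ l, X.IsWalk x l y)
    (hsc : ∀ x l, X.IsWalk x l x → X.Homotopic x l []) :
    LinearMap.ker X.coboundaryOne ≤ LinearMap.range X.coboundaryZero := by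
  intro φ hφ
  rw [LinearMap.mem_ker] at hφ
  choose p hp using hconn x₀
  -- A primitive of φ: integrate along chosen paths from `x₀`.
  refine ⟨fun x => pathSum φ (p x), ?_⟩
  funext q
  induction q using Quotient.inductionOn with
  | _ e =>
    -- The loop out to the source of e, across e and back from its target is null-homotopic, so φ
    -- vanishes on it.
    have hw := ((hp (X.src e)).append (X.isWalk_singleton e)).append (hp (X.tgt e)).reverse
    have h := (hsc _ _ hw).pathSum_eq hφ
    rw [pathSum_append, pathSum_append, pathSum_reverse] at h
    change pathSum φ (p (X.src e)) + pathSum φ (p (X.tgt e)) = φ (Quotient.mk _ e)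
    have h1 : pathSum φ [e] = φ (Quotient.mk _ e) := by simp [pathSum]
    have h2 : pathSum φ ([] : List X.E) = 0 := rfl
    rw [h1, h2, add_right_comm] at h
    exact CharTwo.add_eq_zero.1 h

/-- The Euler characteristic of a finite, connected and simply connected complex is positive. -/
theorem card_geomEdge_lt [Fintype X.V] [Fintype X.F] [Fintype X.GeomEdge] (x₀ : X.V)
    (hconn : ∀ x y, ∃ l, X.IsWalk x l y) (hsc : ∀ x l, X.IsWalk x l x → X.Homotopic x l []) :
    Fintype.card X.GeomEdge < Fintype.card X.V + Fintype.card X.F := by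
  have h0 := LinearMap.finrank_range_add_finrank_ker X.coboundaryZero
  have h1 := LinearMap.finrank_range_add_finrank_ker X.coboundaryOne
  have h2 := Submodule.finrank_mono (ker_coboundaryOne_le x₀ hconn hsc)
  have h3 := Submodule.finrank_le (LinearMap.range X.coboundaryOne)
  -- The constant cochain 1 is a nonzero 0-cocycle; this makes the inequality strict.
  have h4 : 0 < Module.finrank (ZMod 2) (LinearMap.ker X.coboundaryZero) := by
    rw [Module.finrank_pos_iff_exists_ne_zero]
    refine ⟨⟨fun _ => 1, ?_⟩, fun h => ?_⟩
    · rw [LinearMap.mem_ker]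
      funext q
      induction q using Quotient.inductionOn with
      | _ e => exact CharTwo.add_self_eq_zero (1 : ZMod 2)
    · exact one_ne_zero (congrFun (congrArg Subtype.val h) x₀)
  simp only [Module.finrank_fintype_fun_eq_card] at h0 h1 h3
  omega

end Cohomology

/-! ### Counting corners in a closed surface. -/

section Corners

variable {X : TwoComplex.{u}}

variable (X) in
/-- Corners as pairs of a 2-cell and an index. -/
def cornerEquiv : X.Corner ≃ Σ d : X.F, ZMod (X.len d) where
  toFun c := ⟨c.cell, c.idx⟩
  invFun p := ⟨p.1, p.2⟩
  left_inv _ := rfl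
  right_inv _ := rfl

/-- A circuit around a link passes each corner at the vertex exactly once. -/
theorem circuit_corner_bijective {x : X.V} {n : ℕ} {c : ZMod n → (X.lk x).E}
    (hc : (X.lk x).IsCircuit c) :
    Function.Bijective fun i => (⟨(c i).1.1, (c i).2⟩ : {c : X.Corner // c.vertex = x}) := by
  constructor
  · intro i j hij
    have h : (c i).1.1 = (c j).1.1 := congrArg Subtype.val hij
    refine (hc.edge (c j)).unique ?_ (Or.inl rfl)
    rcases Bool.eq_or_eq_not (c i).1.2 (c j).1.2 with h' | h'
    · exact Or.inl (Subtype.ext (Prod.ext h h'))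
    · exact Or.inr (Subtype.ext (Prod.ext h h'))
  · rintro ⟨a, ha⟩
    obtain ⟨i, hi | hi, -⟩ := hc.edge ⟨(a, true), ha⟩
    · exact ⟨i, Subtype.ext (by simp only [hi])⟩
    · exact ⟨i, Subtype.ext (by simp only [hi]; rfl)⟩

theorem circuit_src_bijective {G : SerreGraph.{u}} {n : ℕ} {c : ZMod n → G.E}
    (hc : G.IsCircuit c) : Function.Bijective fun i => G.src (c i) :=
  (Function.bijective_iff_existsUnique _).2 hc.vertex

/-- In a closed surface, there are as many corners as oriented edges. -/
theorem card_corner_eq [Fintype X.Corner] [Fintype X.E] (hX : ∀ x, (X.lk x).IsCircle) :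
    Fintype.card X.Corner = Fintype.card X.E := by
  -- A circle has as many edges as vertices: one circuit indexes both the corners and the edge ends
  -- at x.
  have e : ∀ x, Nonempty ({c : X.Corner // c.vertex = x} ≃ {e : X.E // X.src e = x}) := by
    intro x
    obtain ⟨n, -, c, hc⟩ := hX x
    exact ⟨(Equiv.ofBijective _ (circuit_corner_bijective hc)).symm.trans
      (Equiv.ofBijective _ (circuit_src_bijective hc))⟩
  exact Fintype.card_congr (((Equiv.sigmaFiberEquiv Corner.vertex).symm.trans
    (Equiv.sigmaCongrRight fun x => (e x).some)).trans (Equiv.sigmaFiberEquiv X.src))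

end Corners

/-! ### Angles pulled back along a combinatorial map. -/

namespace CombMap

variable {X : TwoComplex.{u}} {Y : TwoComplex.{v}}

theorem len_onF (f : CombMap X Y) (d : X.F) : Y.len (f.onF d) = X.len d := by
  simpa using (Fintype.card_congr (f.side d)).symm

/-- Pulling back angles along a combinatorial map preserves curvature. -/
theorem curvature_comp (f : CombMap X Y) (ω : Y.Corner → ℝ) (d : X.F) :
    X.curvature (fun c => ω (f.onCorner c)) d = Y.curvature ω (f.onF d) := by
  unfold curvature
  have hlen : (Y.len (f.onF d) : ℝ) = X.len d := congrArg Nat.cast (f.len_onF d)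
  rw [hlen]
  congr 1
  cases h : f.flip d
  · simp only [f.onCorner_of_not_flip h]
    exact (f.side d).sum_comp fun j => ω ⟨f.onF d, j⟩
  -- On a flipped cell corner i goes to `side (i + 1)`, so the bijection is precomposed with a
  -- shift.
  · simp only [f.onCorner_of_flip h]
    exact ((Equiv.addRight 1).trans (f.side d)).sum_comp fun j => ω ⟨f.onF d, j⟩

/-- The angles around a vertex of a thin vertex reduced map sum up to at least `2`. -/
theorem two_le_sum_angle {K : Y.Subcomplex} {ω : Y.Corner → ℝ}
    (htest : Y.RelativeColoringTest K ω) {f : CombMap X Y} (hthin : f.IsThin K)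
    (hred : f.IsVertexReduced) {x : X.V} (hx : (X.lk x).IsCircle)
    [Fintype {c : X.Corner // c.vertex = x}] :
    2 ≤ ∑ c : {c : X.Corner // c.vertex = x}, ω (f.onCorner c.1) := by
  obtain ⟨n, hn, c, hc⟩ := hx
  have : NeZero n := ⟨hn.ne'⟩
  have hb := circuit_corner_bijective hc
  have h := htest.cycle (f.onV x) n _ (hred x n c hc) (by
    intro hK
    obtain ⟨d, ⟨i, hi⟩, hd⟩ := hthin x
    -- The corner with index i - 1 sits at the source of edge i, which is x, so the circuit meets
    -- the cell d outside K.
    obtain ⟨j, hj⟩ := hb.2 ⟨⟨d, i - 1⟩, by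
      change X.src (X.bd d (i - 1 + 1)) = x
      rw [sub_add_cancel, hi]⟩
    have hj' : (c j).1.1 = ⟨d, i - 1⟩ := congrArg Subtype.val hj
    have hm : f.onF (c j).1.1.cell ∈ K.F := hK j
    rw [hj'] at hm
    exact hd hm)
  have hsum := (Equiv.ofBijective _ hb).sum_comp fun c => ω (f.onCorner c.1)
  rw [← hsum]
  exact sub_nonpos.1 h

end CombMap

end TwoComplex

theorem mainTheorem7 (L : TwoComplex.{u}) (K : L.Subcomplex) (ω : L.Corner → ℝ)
    (hω : L.IsZeroOneAngle ω) (htest : L.RelativeColoringTest K ω)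
    (hκ : ∀ d : L.F, L.curvature ω d ≤ 0)
    (S : TwoComplex.{v}) (hS : S.IsSphere) (f : S.CombMap L) (hthin : f.IsThin K) :
    ¬ f.IsVertexReduced := by
  intro hred
  classical
  have := hS.finite_V
  have := hS.finite_E
  have := hS.finite_F
  let := Fintype.ofFinite S.V
  let := Fintype.ofFinite S.E
  let := Fintype.ofFinite S.F
  let := Fintype.ofFinite S.GeomEdge
  let : Fintype S.Corner := Fintype.ofEquiv _ S.cornerEquiv.symm
  obtain ⟨x₀⟩ := hS.nonempty
  have hχ := TwoComplex.card_geomEdge_lt x₀ hS.connected hS.simplyConnected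
  have hE := S.card_edge_eq
  have hC := TwoComplex.card_corner_eq hS.surface
  have hlen : Fintype.card S.Corner = ∑ d, S.len d := by
    rw [Fintype.card_congr S.cornerEquiv, Fintype.card_sigma]
    simp
  have hvert : 2 * (Fintype.card S.V : ℝ) ≤ ∑ c, ω (f.onCorner c) := by
    rw [← (Equiv.sigmaFiberEquiv TwoComplex.Corner.vertex).sum_comp, Fintype.sum_sigma]
    calc 2 * (Fintype.card S.V : ℝ) = ∑ _x : S.V, (2 : ℝ) := by simp [mul_comm]
      _ ≤ _ := Finset.sum_le_sum fun x _ =>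
        TwoComplex.CombMap.two_le_sum_angle htest hthin hred (hS.surface x)
  have hcell : ∑ c, ω (f.onCorner c) ≤ ∑ d, ((S.len d : ℝ) - 2) := by
    rw [← S.cornerEquiv.symm.sum_comp, Fintype.sum_sigma]
    refine Finset.sum_le_sum fun d _ => ?_
    have h := (f.curvature_comp ω d).le.trans (hκ (f.onF d))
    exact sub_nonpos.1 h
  have hsum : ∑ d, ((S.len d : ℝ) - 2) =
      2 * Fintype.card S.GeomEdge - 2 * Fintype.card S.F := by
    -- The total boundary length is the number of corners, hence of oriented edges, which is twice
    -- the number of geometric edges.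
    rw [hC, hE] at hlen
    rw [Finset.sum_sub_distrib, ← Nat.cast_sum, ← hlen]
    simp [mul_comm]
  have hχ' : (Fintype.card S.GeomEdge : ℝ) < Fintype.card S.V + Fintype.card S.F := by
    exact_mod_cast hχ
  linarith
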